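/- **Setting.** Fix an integer $d\ge 2$. The $n$-qudit state space is $\mathcal H(n,d)=(\mathbb C^d)^{\otimes n}\cong\mathbb C^{d^n}$ with orthonormal basis $|c_1\dots c_n\rangle$, $c_i\in\{0,\dots,d-1\}$; write $|0\rangle=|0\dots0\rangle$. A *two-qudit gate* is an arbitrary unitary $V\in U(d^2)$ acting on two distinct qudits, tensored with the identity on all others; a circuit of size $\ell$ is a product of $\ell$ two-qudit gates. For $a\ge 0$, let $\ell_a(U)$ be the least size of a circuit $W$ on $n$ data qudits and $a$ ancilla qudits that implements the unitary $U\in U(d^n)$, i.e. $W(|y\rangle\otimes|0\rangle)=U|y\rangle\otimes|0\rangle$ for all basis states $|y\rangle$. For a unit vector $|\psi\rangle\in\mathcal H(n,d)$, let $s_a(\psi)$ be the least size of such a circuit $W$ with $W(|0\rangle\otimes|0\rangle)=|\psi\rangle\otimes|0\rangle$. (For $a=0$ there are no ancillas: $W=U$, respectively $W|0\rangle=|\psi\rangle$.) **Theorem.** With $d$ fixed, the following hold. 1. (State synthesis needs $\Theta(d^n)$ two-qudit gates.) There are constants $c,C>0$ depending only on $d$ such that for all $n\ge 2$ and all $a\ge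 0$: $s_a(\psi)\ge c\,d^{n}$ for almost every unit vector $|\psi\rangle\in\mathcal H(n,d)$ (with respect to surface measure on the unit sphere), and $s_a(\psi)\le C\,d^{n}$ for every unit vector $|\psi\rangle$. 2. (Generic unitaries need $\Theta(d^{2n})$ two-qudit gates.) There are constants $c,C>0$ depending only on $d$ such that for all $n\ge 2$ and all $a\ge 0$: $\ell_a(U)\ge c\,d^{2n}$ for almost every $U\in U(d^n)$ (with respect to Haar measure), and $\ell_a(U)\le C\,d^{2n}$ for every $U\in U(d^n)$. -/

import Mathlib

open MeasureTheory
open scoped ENNReal NNReal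

noncomputable section

/-- A computational basis label for a register of `d`-level systems ("wires") indexed by `κ`:
the dit string `c` stands for the basis ket `|c⟩`.  The `n`-qudit register is `κ = Fin n`. -/
abbrev Dits (d : ℕ) (κ : Type) : Type := κ → Fin d

/-- A two-qudit gate on a register with wires `κ`: an arbitrary unitary `d² × d²` matrix acting
on an ordered pair of distinct wires. -/
structure TwoQuditGate (d : ℕ) (κ : Type) where
  fst : κ
  snd : κ
  fst_ne_snd : fst ≠ snd
  op : Matrix.unitaryGroup (Fin d × Fin d) ℂ

/-- The operator on the whole register given by a two-qudit gate: `op` on the two chosen wires,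
tensored with the identity on all other wires. -/
def TwoQuditGate.toMatrix {d : ℕ} {κ : Type} [Fintype κ] [DecidableEq κ]
    (g : TwoQuditGate d κ) : Matrix (Dits d κ) (Dits d κ) ℂ :=
  Matrix.of fun x y =>
    if ∀ k, k ≠ g.fst → k ≠ g.snd → x k = y k then
      (g.op : Matrix (Fin d × Fin d) (Fin d × Fin d) ℂ) (x g.fst, x g.snd) (y g.fst, y g.snd)
    else 0

/-- A quantum circuit of two-qudit gates; its size is the length of the list. -/
abbrev QuditCircuit (d : ℕ) (κ : Type) : Type := List (TwoQuditGate d κ)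

/-- The operator `U¹ U² ⋯ U^ℓ` of a circuit. -/
def QuditCircuit.toMatrix {d : ℕ} {κ : Type} [Fintype κ] [DecidableEq κ]
    (L : QuditCircuit d κ) : Matrix (Dits d κ) (Dits d κ) ℂ :=
  (L.map TwoQuditGate.toMatrix).prod

/-- A circuit on `n` data qudits and `a` ancilla qudits implements the `n`-qudit operator `U` if
it maps `|y⟩ ⊗ |0⟩` to `U|y⟩ ⊗ |0⟩` for every data basis state `|y⟩`: the ancillas start in
`|0…0⟩` and are returned to it.  For `a = 0` this says that the circuit's operator is `U`. -/
def QuditCircuit.Implements {d n a : ℕ} [NeZero d] (L : QuditCircuit d (Fin n ⊕ Fin a))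
    (U : Matrix (Dits d (Fin n)) (Dits d (Fin n)) ℂ) : Prop :=
  ∀ (x y : Dits d (Fin n)) (z : Dits d (Fin a)),
    L.toMatrix (Sum.elim x z) (Sum.elim y 0) = if z = 0 then U x y else 0

/-- A circuit on `n` data qudits and `a` ancilla qudits prepares the `n`-qudit state `ψ` if it
maps `|0…0⟩ ⊗ |0…0⟩` to `ψ ⊗ |0…0⟩`.  For `a = 0` this is `U|0…0⟩ = ψ`. -/
def QuditCircuit.Prepares {d n a : ℕ} [NeZero d] (L : QuditCircuit d (Fin n ⊕ Fin a))
    (ψ : EuclideanSpace ℂ (Dits d (Fin n))) : Prop :=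
  ∀ (x : Dits d (Fin n)) (z : Dits d (Fin a)),
    L.toMatrix (Sum.elim x z) 0 = if z = 0 then ψ x else 0

/-- The least number of two-qudit gates in a circuit with `a` ancillas that implements `U`
(`⊤` if there is no such circuit). -/
def unitaryComplexity {d n : ℕ} [NeZero d] (a : ℕ)
    (U : Matrix (Dits d (Fin n)) (Dits d (Fin n)) ℂ) : ℕ∞ :=
  ⨅ (L : QuditCircuit d (Fin n ⊕ Fin a)) (_ : L.Implements U), (L.length : ℕ∞)

/-- The least number of two-qudit gates in a circuit with `a` ancillas that prepares `ψ`
(`⊤` if there is no such circuit). -/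
def stateComplexity {d n : ℕ} [NeZero d] (a : ℕ)
    (ψ : EuclideanSpace ℂ (Dits d (Fin n))) : ℕ∞ :=
  ⨅ (L : QuditCircuit d (Fin n ⊕ Fin a)) (_ : L.Prepares ψ), (L.length : ℕ∞)

/-- The unitary group carries its Borel σ-algebra. -/
instance unitaryGroupMeasurableSpace (ι : Type) [Fintype ι] [DecidableEq ι] :
    MeasurableSpace (Matrix.unitaryGroup ι ℂ) := borel _

instance unitaryGroupBorelSpace (ι : Type) [Fintype ι] [DecidableEq ι] :
    BorelSpace (Matrix.unitaryGroup ι ℂ) := ⟨rfl⟩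

/-- The unitary group is compact, so it has a Haar measure. -/
instance unitaryGroupCompactSpace (ι : Type) [Fintype ι] [DecidableEq ι] :
    CompactSpace (Matrix.unitaryGroup ι ℂ) := by
  have hK : IsCompact (Set.univ.pi fun _ : ι => Set.univ.pi fun _ : ι =>
      Metric.closedBall (0 : ℂ) 1) :=
    isCompact_univ_pi fun _ => isCompact_univ_pi fun _ => isCompact_closedBall _ _
  have hc : IsClosed {A : Matrix ι ι ℂ | star A * A = 1 ∧ A * star A = 1} :=
    (isClosed_eq (by fun_prop) continuous_const).inter
      (isClosed_eq (by fun_prop) continuous_const)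
  refine isCompact_iff_compactSpace.mp (hK.of_isClosed_subset ?_ ?_)
  · exact hc
  · intro A hA i _ j _
    simpa using entry_norm_bound_of_unitary hA i j

/-- The uniform (surface) measure class on the unit sphere of `n`-qudit state vectors. -/
def stateMeasure (d n : ℕ) :
    Measure (Metric.sphere (0 : EuclideanSpace ℂ (Dits d (Fin n))) 1) :=
  (volume : Measure (EuclideanSpace ℂ (Dits d (Fin n)))).toSphere

/-- Haar measure on the group of `n`-qudit unitary operators. -/
def unitaryMeasure (d n : ℕ) : Measure (Matrix.unitaryGroup (Dits d (Fin n)) ℂ) :=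
  Measure.haar

end

/-! Lower bounds are dimension counts. For a fixed wire pattern, the entries of an `l`-gate circuit
are polynomials in the gate entries; dropping unitarity of the gates leaves a vector space of `2 * d
^ 4 * l` real parameters. A C¹ image of a space of too small dimension is null
(`measure_range_eq_zero_of_finrank_lt`), and there are only countably many patterns. Ancillas add
patterns but no parameters, so the bound does not depend on `a`. States are compared with the `2 * d
^ n` real dimensions of the ambient space by coning over the sphere. Unitaries are compared with the
space of all matrices through the polar decomposition (`measure_unitary_preimage_range_eq_zero`).

Upper bounds are constructive and use no ancillas. A diagonal unitary on `k` wires costs at most `3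
* d ^ k` gates (`hasCircuitSize_phaseOp`), by recursion on the wires with phases conjugated by
controlled swaps. Diagonals and Hadamards empty the nonzero levels of one wire after another; the
costs form a geometric series, so any state reaches `|0⟩` in `O(d ^ n)` gates
(`exists_hasCircuitSize_to_zero`). Conjugating a phase on `|0⟩` by such a circuit gives any complex
reflection, and a unitary is a product of at most `d ^ n` of these (`hasCircuitSize_of_fixes`). -/

noncomputable section

/-! ### Parametrised circuits -/

/-- The parameter space of circuits with `l` gates: each gate is an arbitrary `d² × d²` array. -/
abbrev GateParams (d l : ℕ) : Type := Fin l → (Fin d × Fin d) → (Fin d × Fin d) → ℂ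

section
variable {d : ℕ} {κ : Type} [Fintype κ] [DecidableEq κ]

/-- The operator on the register that acts by the array `o` on the wires `p.1` and `p.2`. -/
def wireOp (p : κ × κ) (o : (Fin d × Fin d) → (Fin d × Fin d) → ℂ) :
    Matrix (Dits d κ) (Dits d κ) ℂ :=
  Matrix.of fun x y =>
    if ∀ k, k ≠ p.1 → k ≠ p.2 → x k = y k then o (x p.1, x p.2) (y p.1, y p.2) else 0

/-- The operator of the circuit with wire pattern `w` and gate parameters `o`. -/
def patternOp : (l : ℕ) → (Fin l → κ × κ) → GateParams d l → Matrix (Dits d κ) (Dits d κ) ℂ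
  | 0, _, _ => 1
  | l + 1, w, o => wireOp (w 0) (o 0) * patternOp l (fun i => w i.succ) (fun i => o i.succ)

theorem contDiff_wireOp_apply (p : κ × κ) (x y : Dits d κ) :
    ContDiff ℝ 1 fun o : (Fin d × Fin d) → (Fin d × Fin d) → ℂ => wireOp p o x y := by
  unfold wireOp
  by_cases h : ∀ k, k ≠ p.1 → k ≠ p.2 → x k = y k
  · simp only [Matrix.of_apply, if_pos h]
    fun_prop
  · simp only [Matrix.of_apply, if_neg h]
    fun_prop

theorem contDiff_patternOp_apply (l : ℕ) (w : Fin l → κ × κ) (x y : Dits d κ) :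
    ContDiff ℝ 1 fun o : GateParams d l => patternOp l w o x y := by
  induction l generalizing x y with
  | zero => exact contDiff_const
  | succ l ih =>
    simp only [patternOp, Matrix.mul_apply]
    refine ContDiff.sum fun z _ => ContDiff.mul ?_ ?_
    · exact (contDiff_wireOp_apply (w 0) x z).comp
        (f := fun o : GateParams d (l + 1) => o 0) (by fun_prop)
    · exact (ih (fun i => w i.succ) z y).comp
        (f := fun (o : GateParams d (l + 1)) i => o i.succ) (by fun_prop)

theorem exists_patternOp_eq_toMatrix (L : QuditCircuit d κ) :
    ∃ (w : Fin L.length → κ × κ) (o : GateParams d L.length),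
      patternOp L.length w o = L.toMatrix := by
  induction L with
  | nil => exact ⟨fun i => i.elim0, fun i => i.elim0, rfl⟩
  | cons g L ih =>
    obtain ⟨w, o, h⟩ := ih
    refine ⟨Fin.cons (g.fst, g.snd) w, Fin.cons g.op.1 o, ?_⟩
    change wireOp (g.fst, g.snd) g.op.1 * patternOp L.length w o = _
    rw [h]
    rfl

end

theorem finrank_gateParams (d l : ℕ) :
    Module.finrank ℝ (GateParams d l) = l * (2 * d ^ 4) := by
  simp [GateParams, Module.finrank_pi_fintype]
  left
  ring

/-- A C¹ map does not raise Hausdorff dimension, and additive Haar measure is absolutely continuous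
with respect to Hausdorff measure in the full dimension. -/
theorem measure_range_eq_zero_of_finrank_lt {E F : Type*} [NormedAddCommGroup E]
    [NormedSpace ℝ E] [FiniteDimensional ℝ E] [NormedAddCommGroup F] [NormedSpace ℝ F]
    [FiniteDimensional ℝ F] [MeasurableSpace F] [BorelSpace F] (μ : Measure F)
    [μ.IsAddHaarMeasure] {f : E → F} (hf : ContDiff ℝ 1 f)
    (h : Module.finrank ℝ E < Module.finrank ℝ F) : μ (Set.range f) = 0 := by
  have h0 : μH[(Module.finrank ℝ F : ℝ≥0)] (Set.range f) = 0 :=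
    hausdorffMeasure_of_dimH_lt
      (lt_of_le_of_lt hf.dimH_range_le (by exact_mod_cast h))
  have : μ ≪ μH[(Module.finrank ℝ F : ℝ≥0)] := by
    rw [NNReal.coe_natCast]
    exact Measure.absolutelyContinuous_isAddHaarMeasure _ _
  exact this h0

theorem measurableSet_range_of_continuous {E F : Type*} [TopologicalSpace E]
    [SigmaCompactSpace E] [TopologicalSpace F] [T2Space F] [MeasurableSpace F] [BorelSpace F]
    {f : E → F} (hf : Continuous f) : MeasurableSet (Set.range f) := by
  rw [← Set.image_univ, ← iUnion_compactCovering, Set.image_iUnion]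
  exact MeasurableSet.iUnion fun n =>
    ((isCompact_compactCovering E n).image hf).isClosed.measurableSet

/-! ### Generic states -/

/-- The cone over the states prepared by circuits with a given wire pattern. -/
def preparedCone {d n a : ℕ} [NeZero d] (l : ℕ)
    (w : Fin l → (Fin n ⊕ Fin a) × (Fin n ⊕ Fin a)) (q : ℝ × GateParams d l) :
    EuclideanSpace ℂ (Dits d (Fin n)) :=
  WithLp.toLp 2 fun x => (q.1 : ℂ) * patternOp l w q.2 (Sum.elim x 0) 0

theorem contDiff_preparedCone {d n a : ℕ} [NeZero d] (l : ℕ)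
    (w : Fin l → (Fin n ⊕ Fin a) × (Fin n ⊕ Fin a)) :
    ContDiff ℝ 1 (preparedCone (d := d) l w) := by
  rw [contDiff_piLp]
  intro x
  simp only [preparedCone]
  refine ContDiff.mul ?_ ?_
  · exact Complex.ofRealCLM.contDiff.comp contDiff_fst
  · exact (contDiff_patternOp_apply l w (Sum.elim x 0) 0).comp contDiff_snd

theorem finrank_state (d n : ℕ) :
    Module.finrank ℝ (EuclideanSpace ℂ (Dits d (Fin n))) = 2 * d ^ n := by
  rw [finrank_real_of_complex, finrank_euclideanSpace]
  simp

theorem stateMeasure_prepared_eq_zero {d n a : ℕ} [NeZero d] (l : ℕ)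
    (w : Fin l → (Fin n ⊕ Fin a) × (Fin n ⊕ Fin a)) (hl : 1 + l * (2 * d ^ 4) < 2 * d ^ n) :
    stateMeasure d n (Subtype.val ⁻¹' Set.range (preparedCone (d := d) l w)) = 0 := by
  have hc := contDiff_preparedCone (d := d) l w
  have hm : MeasurableSet (Set.range (preparedCone (d := d) l w)) :=
    measurableSet_range_of_continuous hc.continuous
  have h0 : (volume : Measure (EuclideanSpace ℂ (Dits d (Fin n))))
      (Set.range (preparedCone (d := d) l w)) = 0 := by
    refine measure_range_eq_zero_of_finrank_lt _ hc ?_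
    rw [finrank_state, Module.finrank_prod, finrank_gateParams, Module.finrank_self]
    exact hl
  -- Surface measure of a set is a multiple of the volume of the cone over it. The real factor in
  -- `preparedCone` makes its range stable under scaling, so the range contains that cone; this
  -- factor is the `1 +` in the count.
  rw [stateMeasure, Measure.toSphere_apply' _ (measurable_subtype_coe hm)]
  refine mul_eq_zero_of_right _ (measure_mono_null ?_ h0)
  rintro _ ⟨t, _, _, ⟨ψ, ⟨q, hq⟩, rfl⟩, rfl⟩
  refine ⟨(t * q.1, q.2), ?_⟩
  change _ = t • (ψ : EuclideanSpace ℂ (Dits d (Fin n)))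
  rw [← hq]
  ext x
  simp [preparedCone, mul_assoc]

theorem ae_le_stateComplexity (d : ℕ) [NeZero d] (n a : ℕ) :
    ∀ᵐ ψ : Metric.sphere (0 : EuclideanSpace ℂ (Dits d (Fin n))) 1 ∂(stateMeasure d n),
      ∀ L : QuditCircuit d (Fin n ⊕ Fin a),
        L.Prepares (ψ : EuclideanSpace ℂ (Dits d (Fin n))) →
          2 * d ^ n ≤ 1 + L.length * (2 * d ^ 4) := by
  have h : ∀ᵐ ψ : Metric.sphere (0 : EuclideanSpace ℂ (Dits d (Fin n))) 1 ∂(stateMeasure d n),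
      ∀ (l : ℕ) (w : Fin l → (Fin n ⊕ Fin a) × (Fin n ⊕ Fin a)),
        1 + l * (2 * d ^ 4) < 2 * d ^ n →
          (ψ : EuclideanSpace ℂ (Dits d (Fin n))) ∉ Set.range (preparedCone (d := d) l w) := by
    rw [ae_all_iff]
    intro l
    rw [ae_all_iff]
    intro w
    by_cases hl : 1 + l * (2 * d ^ 4) < 2 * d ^ n
    · have := stateMeasure_prepared_eq_zero l w hl
      rw [measure_eq_zero_iff_ae_notMem] at this
      filter_upwards [this] with ψ hψ _ using hψ
    · exact Filter.Eventually.of_forall fun _ h => absurd h hl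
  filter_upwards [h] with ψ hψ L hL
  by_contra! hlt
  obtain ⟨w, o, ho⟩ := exists_patternOp_eq_toMatrix L
  refine hψ L.length w hlt ⟨(1, o), ?_⟩
  ext x
  simp only [preparedCone, ho]
  rw [hL x 0]
  simp

/-! ### Generic unitaries -/

section
variable {ι : Type}

instance unitaryGroupSecondCountable [Fintype ι] [DecidableEq ι] : SecondCountableTopology (Matrix.unitaryGroup ι ℂ) :=
  inferInstanceAs (SecondCountableTopology {A : ι → ι → ℂ // A ∈ Matrix.unitaryGroup ι ℂ})

/-- The linear parametrisation of Hermitian matrices by real matrices. -/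
def hermitianOf (A : ι → ι → ℝ) : Matrix ι ι ℂ :=
  Matrix.of fun i j => ((A i j + A j i : ℝ) : ℂ) / 2 + ((A i j - A j i : ℝ) : ℂ) / 2 * Complex.I

theorem contDiff_hermitianOf_apply [Fintype ι] (i j : ι) :
    ContDiff ℝ 1 fun A : ι → ι → ℝ => hermitianOf A i j := by
  simp only [hermitianOf, Matrix.of_apply]
  have h (i j : ι) : ContDiff ℝ 1 fun A : ι → ι → ℝ => A i j := by fun_prop
  refine ContDiff.add (ContDiff.div_const ?_ _) (ContDiff.mul (ContDiff.div_const ?_ _) contDiff_const)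
  · exact Complex.ofRealCLM.contDiff.comp ((h i j).add (h j i))
  · exact Complex.ofRealCLM.contDiff.comp ((h i j).sub (h j i))

theorem Matrix.IsHermitian.exists_hermitianOf {Q : Matrix ι ι ℂ} (hQ : Q.IsHermitian) :
    ∃ A, hermitianOf A = Q := by
  -- The real part of a Hermitian matrix is symmetric and the imaginary part antisymmetric, so both
  -- are recovered from their sum.
  refine ⟨fun i j => (Q i j).re + (Q i j).im, ?_⟩
  ext i j
  have h := hQ.apply i j
  have hr : (Q j i).re = (Q i j).re := by rw [← h]; simp
  have hi : (Q j i).im = -(Q i j).im := by rw [← h]; simp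
  simp only [hermitianOf, Matrix.of_apply, hr, hi]
  conv_rhs => rw [← Complex.re_add_im (Q i j)]
  push_cast
  ring

open scoped MatrixOrder Matrix.Norms.L2Operator in
-- Polar decomposition, with `Q` the positive square root of `M * star M`.
theorem Matrix.exists_isHermitian_mul_unitary [Fintype ι] [DecidableEq ι] {M : Matrix ι ι ℂ} (hM : IsUnit M) :
    ∃ Q : Matrix ι ι ℂ, ∃ V : Matrix.unitaryGroup ι ℂ, Q.IsHermitian ∧ M = Q * V.1 := by
  have hpos : 0 ≤ M * star M := mul_star_self_nonneg M
  set Q := CFC.sqrt (M * star M) with hQ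
  have hQQ : Q * Q = M * star M := CFC.sqrt_mul_sqrt_self _ hpos
  have hQh : star Q = Q := (CFC.sqrt_nonneg (M * star M)).isSelfAdjoint
  have hQu : IsUnit Q := by
    have : IsUnit (Q * Q) := by rw [hQQ]; exact hM.mul hM.star
    rw [Matrix.isUnit_iff_isUnit_det] at this ⊢
    rw [Matrix.det_mul] at this
    exact isUnit_of_mul_isUnit_left this
  have hdet := (Matrix.isUnit_iff_isUnit_det Q).1 hQu
  refine ⟨Q, ⟨Q⁻¹ * M, ?_⟩, hQh, ?_⟩
  · rw [Matrix.mem_unitaryGroup_iff, star_mul, mul_assoc, ← mul_assoc M, ← hQQ]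
    have : star Q⁻¹ = Q⁻¹ := by
      rw [Matrix.star_eq_conjTranspose, Matrix.conjTranspose_nonsing_inv,
        ← Matrix.star_eq_conjTranspose, hQh]
    rw [this, mul_assoc, Matrix.mul_nonsing_inv _ hdet, mul_one, Matrix.nonsing_inv_mul _ hdet]
  · rw [Matrix.mul_nonsing_inv_cancel_left _ _ hdet]

/-- A set of unitaries in the range of a `C¹` map of fewer than `N²` real parameters is null
for every left-invariant finite measure. -/
theorem measure_unitary_preimage_range_eq_zero [Fintype ι] [DecidableEq ι] {E : Type*} [NormedAddCommGroup E]
    [NormedSpace ℝ E] [FiniteDimensional ℝ E] (μ : Measure (Matrix.unitaryGroup ι ℂ))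
    [IsFiniteMeasure μ] [μ.IsMulLeftInvariant] {f : E → Matrix ι ι ℂ}
    (hf : ∀ i j, ContDiff ℝ 1 fun e => f e i j)
    (h : Module.finrank ℝ E < Fintype.card ι ^ 2) :
    μ (Subtype.val ⁻¹' Set.range f) = 0 := by
  -- With `N = Fintype.card ι`, the Hermitian factor adds `N ^ 2` parameters, so the total stays
  -- below `2 * N ^ 2`, the real dimension of the matrix space.
  let G : (ι → ι → ℝ) × E → ι → ι → ℂ := fun q => hermitianOf q.1 * f q.2
  have hG (W : Matrix ι ι ℂ) : ContDiff ℝ 1 fun q => Matrix.of.symm (Matrix.of (G q) * W) := by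
    rw [contDiff_pi]
    intro i
    rw [contDiff_pi]
    intro j
    simp only [G]
    exact ContDiff.sum fun k _ => ContDiff.mul (ContDiff.sum fun m _ => ContDiff.mul
      ((contDiff_hermitianOf_apply i m).comp contDiff_fst) ((hf m k).comp contDiff_snd))
      contDiff_const
  have hdim : Module.finrank ℝ ((ι → ι → ℝ) × E) < Module.finrank ℝ (ι → ι → ℂ) := by
    simp only [Module.finrank_prod, Module.finrank_pi_fintype, Module.finrank_self,
      Complex.finrank_real_complex, Finset.sum_const, Finset.card_univ, smul_eq_mul]
    nlinarith
  have hG1 : ContDiff ℝ 1 G := by simpa using hG 1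
  have hm : MeasurableSet (Set.range G) := measurableSet_range_of_continuous hG1.continuous
  let ν : Measure (ι → ι → ℂ) := Measure.addHaar
  let act : (ι → ι → ℂ) × Matrix.unitaryGroup ι ℂ → ι → ι → ℂ :=
    fun p => Matrix.of.symm (Matrix.of p.1 * p.2.1)
  have hact : Continuous act := by
    have : Continuous fun p : Matrix ι ι ℂ × Matrix.unitaryGroup ι ℂ => p.1 * p.2.1 := by
      fun_prop
    exact this
  have hB : MeasurableSet (act ⁻¹' Set.range G) := hact.measurable hm
  -- Fubini on the pairs `(M, U)` with `M * U` in the range of `G`: for fixed `U` the slice is that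
  -- range times `star U`, again a C¹ image of too small dimension.
  have hz : (ν.prod μ) (act ⁻¹' Set.range G) = 0 := by
    rw [Measure.prod_apply_symm hB]
    refine lintegral_eq_zero_of_ae_eq_zero (Filter.Eventually.of_forall fun U => ?_)
    refine measure_mono_null ?_ (measure_range_eq_zero_of_finrank_lt ν (hG (star U.1)) hdim)
    rintro M ⟨q, hq⟩
    refine ⟨q, ?_⟩
    change Matrix.of (G q) * star U.1 = M
    change G q = _ at hq
    rw [hq]
    change (Matrix.of M) * U.1 * star U.1 = M
    rw [mul_assoc, (Matrix.mem_unitaryGroup_iff).1 U.2, mul_one]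
    rfl
  rw [Measure.measure_prod_null hB] at hz
  have hopen : IsOpen {M : ι → ι → ℂ | (Matrix.of M).det ≠ 0} := by
    have : Continuous fun M : Matrix ι ι ℂ => M.det := by fun_prop
    exact isOpen_ne.preimage this
  have hne : {M : ι → ι → ℂ | (Matrix.of M).det ≠ 0}.Nonempty :=
    ⟨Matrix.of.symm 1, by simp⟩
  -- Slicing the other way, almost every `M` has a null set of `U`; one such `M` is invertible, `M =
  -- Q * V`. If `V * U = f e`, then `M * U = Q * f e` lies in the range of `G`, so left invariance
  -- under `V` finishes.
  obtain ⟨M, hMdet, hM0⟩ := (Measure.dense_of_ae hz).inter_open_nonempty _ hopen hne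
  obtain ⟨Q, V, hQ, hQV⟩ := Matrix.exists_isHermitian_mul_unitary
    ((Matrix.isUnit_iff_isUnit_det (Matrix.of M)).2 (isUnit_iff_ne_zero.2 hMdet))
  obtain ⟨A, rfl⟩ := hQ.exists_hermitianOf
  rw [← measure_preimage_mul μ V]
  refine measure_mono_null ?_ hM0
  rintro U ⟨e, he⟩
  refine ⟨(A, e), ?_⟩
  change hermitianOf A * f e = (Matrix.of M) * U.1
  rw [he, hQV, mul_assoc]
  rfl

end

theorem ae_le_unitaryComplexity (d : ℕ) [NeZero d] (n a : ℕ) :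
    ∀ᵐ U : Matrix.unitaryGroup (Dits d (Fin n)) ℂ ∂(unitaryMeasure d n),
      ∀ L : QuditCircuit d (Fin n ⊕ Fin a),
        L.Implements (U : Matrix (Dits d (Fin n)) (Dits d (Fin n)) ℂ) →
          d ^ (2 * n) ≤ L.length * (2 * d ^ 4) := by
  let F (l : ℕ) (w : Fin l → (Fin n ⊕ Fin a) × (Fin n ⊕ Fin a)) (o : GateParams d l) :
      Matrix (Dits d (Fin n)) (Dits d (Fin n)) ℂ :=
    Matrix.of fun x y => patternOp l w o (Sum.elim x 0) (Sum.elim y 0)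
  have h : ∀ᵐ U : Matrix.unitaryGroup (Dits d (Fin n)) ℂ ∂(unitaryMeasure d n),
      ∀ (l : ℕ) (w : Fin l → (Fin n ⊕ Fin a) × (Fin n ⊕ Fin a)),
        l * (2 * d ^ 4) < d ^ (2 * n) → U.1 ∉ Set.range (F l w) := by
    rw [ae_all_iff]
    intro l
    rw [ae_all_iff]
    intro w
    by_cases hl : l * (2 * d ^ 4) < d ^ (2 * n)
    · have : unitaryMeasure d n (Subtype.val ⁻¹' Set.range (F l w)) = 0 := by
        unfold unitaryMeasure
        refine measure_unitary_preimage_range_eq_zero _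
          (fun x y => contDiff_patternOp_apply l w _ _) ?_
        rw [finrank_gateParams]
        simpa [← pow_mul, mul_comm n 2] using hl
      rw [measure_eq_zero_iff_ae_notMem] at this
      filter_upwards [this] with U hU _ using hU
    · exact Filter.Eventually.of_forall fun _ h => absurd h hl
  filter_upwards [h] with U hU L hL
  by_contra! hlt
  obtain ⟨w, o, ho⟩ := exists_patternOp_eq_toMatrix L
  refine hU L.length w hlt ⟨o, ?_⟩
  ext x y
  simp only [F, Matrix.of_apply, ho]
  rw [hL x y 0]
  simp

/-! ### Controlled swaps of levels -/

/-- Swap the levels `0` and `j` of wire `t` if wire `m` is in level `v`. -/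
def controlledSwap {d : ℕ} {κ : Type} [DecidableEq κ] [NeZero d] (m t : κ) (v j : Fin d) (x : Dits d κ) : Dits d κ :=
  if x m = v then Function.update x t (Equiv.swap 0 j (x t)) else x

theorem controlledSwap_involutive {d : ℕ} {κ : Type} [DecidableEq κ] [NeZero d] {m t : κ} (hmt : m ≠ t) (v j : Fin d) :
    Function.Involutive (controlledSwap m t v j) := by
  intro x
  by_cases h : x m = v <;> simp [controlledSwap, h, hmt]

/-! ### Operators of bounded circuit size -/

section
variable {d : ℕ} {κ : Type} [Fintype κ] [DecidableEq κ]

theorem wireOp_mul {p q : κ} (hpq : p ≠ q) (A B : Matrix (Fin d × Fin d) (Fin d × Fin d) ℂ) :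
    wireOp (p, q) A * wireOp (p, q) B = wireOp (p, q) (A * B) := by
  ext x y
  simp only [Matrix.mul_apply, wireOp, Matrix.of_apply]
  split_ifs with hxy
  · rw [← Finset.sum_filter_of_ne (p := fun z : Dits d κ => ∀ k, k ≠ p → k ≠ q → x k = z k)]
    · refine Finset.sum_nbij' (fun z => (z p, z q))
        (fun c => Function.update (Function.update x p c.1) q c.2) ?_ ?_ ?_ ?_ ?_
      · simp
      · intro c _
        simp only [Finset.mem_filter, Finset.mem_univ, true_and]
        intro k hp hq
        simp [hp, hq]
      · intro z hz
        simp only [Finset.mem_filter, Finset.mem_univ, true_and] at hz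
        ext k
        by_cases hq : k = q
        · simp [hq]
        by_cases hp : k = p
        · subst hp
          simp [hq]
        · simp [hp, hq, hz k hp hq]
      · rintro ⟨a, b⟩ _
        simp [hpq]
      · intro z hz
        simp only [Finset.mem_filter, Finset.mem_univ, true_and] at hz
        have hzy : ∀ k, k ≠ p → k ≠ q → z k = y k := fun k h1 h2 =>
          (hz k h1 h2).symm.trans (hxy k h1 h2)
        rw [if_pos hz, if_pos hzy]
    · intro z _ hne
      by_contra h
      simp [h] at hne
  · refine Finset.sum_eq_zero fun z _ => ?_
    by_cases h1 : ∀ k, k ≠ p → k ≠ q → x k = z k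
    · have h2 : ¬ ∀ k, k ≠ p → k ≠ q → z k = y k := fun h2 =>
        hxy fun k hp hq => (h1 k hp hq).trans (h2 k hp hq)
      rw [if_neg h2, mul_zero]
    · rw [if_neg h1, zero_mul]

theorem wireOp_diagonal (p q : κ) (φ : Fin d × Fin d → ℂ) :
    wireOp (p, q) (Matrix.diagonal φ) = Matrix.diagonal fun x => φ (x p, x q) := by
  ext x y
  simp only [wireOp, Matrix.of_apply, Matrix.diagonal_apply, Prod.mk.injEq]
  by_cases h : x = y
  · simp [h]
  · rw [if_neg h]
    split_ifs with h1 h2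
    · refine absurd (funext fun k => ?_) h
      by_cases hp : k = p
      · rw [hp, h2.1]
      by_cases hq : k = q
      · rw [hq, h2.2]
      exact h1 k hp hq
    · rfl
    · rfl

theorem wireOp_conjTranspose (p : κ × κ) (A : Matrix (Fin d × Fin d) (Fin d × Fin d) ℂ) :
    (wireOp p A).conjTranspose = wireOp p A.conjTranspose := by
  ext x y
  simp only [wireOp, Matrix.of_apply, Matrix.conjTranspose_apply]
  rw [apply_ite star, star_zero]
  simp only [eq_comm]

/-- `M` is the operator of a circuit with at most `c` two-qudit gates. -/
def HasCircuitSize (M : Matrix (Dits d κ) (Dits d κ) ℂ) (c : ℕ) : Prop :=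
  ∃ L : QuditCircuit d κ, L.toMatrix = M ∧ L.length ≤ c

namespace HasCircuitSize

variable {M N : Matrix (Dits d κ) (Dits d κ) ℂ} {b c : ℕ}

theorem mono (h : HasCircuitSize M b) (hbc : b ≤ c) : HasCircuitSize M c := by
  obtain ⟨L, h1, h2⟩ := h
  exact ⟨L, h1, h2.trans hbc⟩

theorem one : HasCircuitSize (1 : Matrix (Dits d κ) (Dits d κ) ℂ) 0 := ⟨[], rfl, le_rfl⟩

theorem mul (hM : HasCircuitSize M b) (hN : HasCircuitSize N c) :
    HasCircuitSize (M * N) (b + c) := by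
  obtain ⟨L, rfl, h1⟩ := hM
  obtain ⟨L', rfl, h2⟩ := hN
  exact ⟨L ++ L', by simp [QuditCircuit.toMatrix], by simpa using Nat.add_le_add h1 h2⟩

theorem of_wireOp {p q : κ} (hpq : p ≠ q) {A : Matrix (Fin d × Fin d) (Fin d × Fin d) ℂ}
    (hA : A ∈ Matrix.unitaryGroup (Fin d × Fin d) ℂ) : HasCircuitSize (wireOp (p, q) A) 1 :=
  ⟨[⟨p, q, hpq, ⟨A, hA⟩⟩], mul_one _, le_rfl⟩

theorem conjTranspose (hM : HasCircuitSize M c) : HasCircuitSize M.conjTranspose c := by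
  obtain ⟨L, rfl, h⟩ := hM
  refine mono ?_ h
  clear h
  induction L with
  | nil => simpa [QuditCircuit.toMatrix] using one
  | cons g L ih =>
    have : QuditCircuit.toMatrix (g :: L) =
        wireOp (g.fst, g.snd) g.op.1 * QuditCircuit.toMatrix L := rfl
    rw [this, Matrix.conjTranspose_mul, wireOp_conjTranspose]
    exact ih.mul (of_wireOp g.fst_ne_snd (star g.op).2)

theorem mem_unitaryGroup (hM : HasCircuitSize M c) : M ∈ Matrix.unitaryGroup (Dits d κ) ℂ := by
  obtain ⟨L, rfl, h⟩ := hM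
  refine Submonoid.list_prod_mem _ fun A hA => ?_
  obtain ⟨g, _, rfl⟩ := List.mem_map.1 hA
  rw [Matrix.mem_unitaryGroup_iff]
  change wireOp (g.fst, g.snd) g.op.1 * (wireOp (g.fst, g.snd) g.op.1).conjTranspose = 1
  rw [wireOp_conjTranspose, wireOp_mul g.fst_ne_snd, ← Matrix.star_eq_conjTranspose,
    (Matrix.mem_unitaryGroup_iff).1 g.op.2, ← Matrix.diagonal_one, wireOp_diagonal,
    Matrix.diagonal_one]

end HasCircuitSize

/-! ### Phases -/

/-- The diagonal unitary `|x⟩ ↦ e^{i f(x)} |x⟩`. -/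
def phaseOp {ι : Type} [DecidableEq ι] (f : ι → ℝ) : Matrix ι ι ℂ :=
  Matrix.diagonal fun x => Complex.exp (f x * Complex.I)

theorem phaseOp_add {ι : Type} [Fintype ι] [DecidableEq ι] (f g : ι → ℝ) :
    phaseOp (fun x => f x + g x) = phaseOp f * phaseOp g := by
  simp [phaseOp, Matrix.diagonal_mul_diagonal, ← Complex.exp_add, add_mul]

theorem phaseOp_mem_unitaryGroup {ι : Type} [Fintype ι] [DecidableEq ι] (f : ι → ℝ) :
    phaseOp f ∈ Matrix.unitaryGroup ι ℂ := by
  rw [Matrix.mem_unitaryGroup_iff, Matrix.star_eq_conjTranspose, phaseOp,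
    Matrix.diagonal_conjTranspose, Matrix.diagonal_mul_diagonal, ← Matrix.diagonal_one]
  congr 1
  ext x
  simp [← Complex.exp_conj, ← Complex.exp_add]

theorem HasCircuitSize.phaseOp_sum {α : Type*} [DecidableEq α] {c : ℕ} (S : Finset α)
    (F : α → Dits d κ → ℝ) (h : ∀ v ∈ S, HasCircuitSize (phaseOp (F v)) c) :
    HasCircuitSize (phaseOp fun x => ∑ v ∈ S, F v x) (S.card * c) := by
  induction S using Finset.induction_on with
  | empty => simpa [phaseOp] using HasCircuitSize.one
  | insert v S hv ih =>
    simp only [Finset.sum_insert hv, phaseOp_add, Finset.card_insert_of_notMem hv, add_mul,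
      one_mul]
    rw [add_comm]
    exact (h v (Finset.mem_insert_self v S)).mul
      (ih fun u hu => h u (Finset.mem_insert_of_mem hu))

/-- A one-qudit gate is a two-qudit gate with an idle partner, which exists since there are at least
two wires. -/
theorem HasCircuitSize.phaseOp_wire [Nontrivial κ] (t : κ) (φ : Fin d → ℝ) :
    HasCircuitSize (phaseOp fun x : Dits d κ => φ (x t)) 1 := by
  obtain ⟨q, hq⟩ := exists_ne t
  have := HasCircuitSize.of_wireOp hq.symm
    (phaseOp_mem_unitaryGroup fun c : Fin d × Fin d => φ c.1)
  rwa [phaseOp, wireOp_diagonal] at this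

theorem hasCircuitSize_controlledSwap [NeZero d] {m t : κ} (hmt : m ≠ t) (v j : Fin d) :
    HasCircuitSize
      ((controlledSwap_involutive hmt v j).toPerm.permMatrix ℂ) 1 := by
  have hτ : Function.Involutive fun c : Fin d × Fin d =>
      if c.1 = v then (c.1, Equiv.swap 0 j c.2) else c := by
    rintro ⟨a, b⟩
    by_cases h : a = v <;> simp [h]
  have hU : hτ.toPerm.permMatrix ℂ ∈ Matrix.unitaryGroup (Fin d × Fin d) ℂ := by
    rw [Matrix.mem_unitaryGroup_iff, Matrix.star_eq_conjTranspose,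
      Matrix.conjTranspose_permMatrix, ← Matrix.permMatrix_mul]
    simp
  convert HasCircuitSize.of_wireOp hmt hU using 1
  ext x y
  simp only [wireOp, Matrix.of_apply, Equiv.Perm.permMatrix, PEquiv.toMatrix_apply,
    Equiv.toPEquiv_apply, Function.Involutive.coe_toPerm, Option.mem_def, Option.some.injEq]
  rw [← ite_and]
  congr 1
  rw [eq_iff_iff]
  constructor
  · rintro rfl
    unfold controlledSwap
    constructor
    · intro k hm ht
      split_ifs <;> simp [ht]
    · split_ifs <;> simp [hmt]
  · rintro ⟨h1, h2⟩
    ext k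
    unfold controlledSwap
    by_cases hv : x m = v
    · simp only [hv, if_true, Prod.mk.injEq] at h2 ⊢
      by_cases ht : k = t
      · subst ht; simp [h2.2]
      by_cases hm : k = m
      · subst hm; simp [ht, hv, h2.1]
      · simp [ht, h1 k hm ht]
    · simp only [hv, if_false, Prod.mk.injEq] at h2 ⊢
      by_cases ht : k = t
      · subst ht; simp [h2.2]
      by_cases hm : k = m
      · subst hm; simp [h2.1]
      · simp [h1 k hm ht]

/-- Conjugating a diagonal matrix by a permutation matrix permutes its entries. -/
theorem HasCircuitSize.phaseOp_comp_controlledSwap [NeZero d] {m t : κ} (hmt : m ≠ t)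
    (v j : Fin d) {f : Dits d κ → ℝ} {c : ℕ} (h : HasCircuitSize (phaseOp f) c) :
    HasCircuitSize (phaseOp (f ∘ controlledSwap m t v j)) (1 + c + 1) := by
  have hs := hasCircuitSize_controlledSwap hmt v j
  have := (hs.mul h).mul hs
  convert this using 1
  rw [Equiv.Perm.permMatrix, PEquiv.toMatrix_toPEquiv_mul, PEquiv.mul_toMatrix_toPEquiv,
    Matrix.submatrix_submatrix, phaseOp, phaseOp, Function.Involutive.toPerm_symm]
  exact (Matrix.submatrix_diagonal_equiv (fun x : Dits d κ => Complex.exp (f x * Complex.I))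
    (controlledSwap_involutive hmt v j).toPerm).symm

end

/-! ### Diagonal unitaries -/

theorem sub_one_mul_add_self {m : ℕ} (hm : 0 < m) (k : ℕ) : (m - 1) * k + k = m * k := by
  rw [← Nat.succ_mul, Nat.succ_eq_add_one, Nat.sub_add_cancel hm]

section
variable {d : ℕ} {κ : Type}

/-- `+1` at level `0`, `-1` at level `j`, and `0` at the other levels. -/
def levelSign [NeZero d] (j y : Fin d) : ℝ := if y = 0 then 1 else if y = j then -1 else 0

/-- Qudit form of `X Z X = -Z`: a controlled swap flips the sign of a phase exactly when the control
wire is at the chosen level. -/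
theorem levelSign_swap [NeZero d] {j : Fin d} (hj : j ≠ 0) (y : Fin d) :
    levelSign j (Equiv.swap 0 j y) = -levelSign j y := by
  by_cases h0 : y = 0
  · subst h0; simp [levelSign, hj]
  by_cases h1 : y = j
  · subst h1; simp [levelSign, hj]
  · rw [Equiv.swap_apply_of_ne_of_ne h0 h1]
    simp [levelSign, h0, h1]

theorem DependsOn.comp_update_insert [DecidableEq κ] {β : Type*} {A : Finset κ} {t : κ}
    {f : Dits d κ → β} (hf : DependsOn f (insert t A : Finset κ)) (v : Fin d) :
    DependsOn (fun x => f (Function.update x t v)) A := by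
  intro x y hxy
  refine hf fun k hk => ?_
  by_cases h : k = t
  · subst h; simp
  · simp only [Finset.coe_insert, Set.mem_insert_iff, h, false_or] at hk
    simp [h, hxy k hk]

/-- A phase that is a product of a function of the wires in `A` and a level sign on a further
wire takes fewer than `3 d ^ |A|` gates. -/
theorem hasCircuitSize_phaseOp_levelSign [Fintype κ] [DecidableEq κ] [NeZero d] [Nontrivial κ]
    (t : κ) {j : Fin d} (hj : j ≠ 0) (A : Finset κ) (htA : t ∉ A) (h : Dits d κ → ℝ)
    (hA : DependsOn h A) :
    HasCircuitSize (phaseOp fun x => h x * levelSign j (x t)) (3 * d ^ A.card - 2) := by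
  induction A using Finset.induction_on generalizing h with
  | empty =>
    have hc (x : Dits d κ) : h x = h 0 := DependsOn.empty (by simpa using hA) x 0
    have := HasCircuitSize.phaseOp_wire (κ := κ) t fun y : Fin d => h 0 * levelSign j y
    simp only [hc]
    simpa using this
  | insert m A hm ih =>
    have hmt : m ≠ t := fun e => htA (e ▸ Finset.mem_insert_self m A)
    have htA' : t ∉ A := fun e => htA (Finset.mem_insert_of_mem e)
    let u (v : Fin d) (x : Dits d κ) : ℝ := h (Function.update x m v)
    have hu (v : Fin d) : DependsOn (u v) A := hA.comp_update_insert v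
    -- The conjugated term for `v` contributes `g v`, or `-g v` when `x m = v`. Added to `u 0 - ∑ g
    -- v` over `v ≠ 0`, this gives `u 0 - 2 * g v = u v` at level `v ≠ 0`, and `u 0` at level `0`.
    let g (v : Fin d) (x : Dits d κ) : ℝ := (u 0 x - u v x) / 2
    have hg (v : Fin d) : DependsOn (g v) A := fun x y hxy => by
      simp only [g, hu 0 hxy, hu v hxy]
    have hr : DependsOn (fun x => u 0 x - ∑ v ∈ Finset.univ.erase 0, g v x) A := fun x y hxy => by
      simp only [hu 0 hxy, hg _ hxy]
    have hgt (v : Fin d) (x : Dits d κ) (y : Fin d) : g v (Function.update x t y) = g v x := by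
      refine hg v fun k hk => ?_
      rw [Function.update_of_ne]
      rintro rfl
      exact htA' hk
    have hterm (v : Fin d) : HasCircuitSize
        (phaseOp ((fun x : Dits d κ => g v x * levelSign j (x t)) ∘ controlledSwap m t v j))
        (3 * d ^ A.card) := by
      have hpos : 0 < d ^ A.card := pow_pos (NeZero.pos d) _
      -- The `- 2` in the inductive bound pays for the two swaps.
      exact ((ih htA' (g v) (hg v)).phaseOp_comp_controlledSwap hmt v j).mono (by omega)
    have hsum := HasCircuitSize.phaseOp_sum (Finset.univ.erase (0 : Fin d)) _
      fun v _ => hterm v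
    have htot := (ih htA' _ hr).mul hsum
    rw [← phaseOp_add] at htot
    refine HasCircuitSize.mono
      (b := 3 * d ^ A.card - 2 + (Finset.univ.erase (0 : Fin d)).card * (3 * d ^ A.card)) ?_ ?_
    · convert htot using 3 with x
      have hs (v : Fin d) : ((fun x : Dits d κ => g v x * levelSign j (x t)) ∘
          controlledSwap m t v j) x
            = g v x * levelSign j (x t) - if x m = v then 2 * g v x * levelSign j (x t) else 0 := by
        simp only [Function.comp_apply, controlledSwap]
        split_ifs with hv
        · rw [hgt, Function.update_self, levelSign_swap hj]
          ring
        · ring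
      simp only [hs, Finset.sum_sub_distrib, ← Finset.sum_mul, Finset.sum_ite_eq]
      have hself : u (x m) x = h x := by simp [u]
      by_cases h0 : x m = 0
      · rw [h0] at hself
        simp [h0, hself]
        ring
      · simp [h0, g, hself]
        ring
    · rw [Finset.card_erase_of_mem (Finset.mem_univ _), Finset.card_univ, Fintype.card_fin,
        Finset.card_insert_of_notMem hm, pow_succ]
      have hpos : 0 < d ^ A.card := pow_pos (NeZero.pos d) _
      have : (d - 1) * (3 * d ^ A.card) + 3 * d ^ A.card = 3 * (d ^ A.card * d) := by
        rw [sub_one_mul_add_self (NeZero.pos d)]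
        ring
      omega

/-- A diagonal unitary depending only on the wires in `A` takes at most `3 d ^ |A|` gates. -/
theorem hasCircuitSize_phaseOp [Fintype κ] [DecidableEq κ] [NeZero d] [Nontrivial κ]
    (A : Finset κ) (f : Dits d κ → ℝ) (hA : DependsOn f A) :
    HasCircuitSize (phaseOp f) (3 * d ^ A.card) := by
  induction A using Finset.induction_on generalizing f with
  | empty =>
    have hc : f = fun _ => f 0 := funext fun x => DependsOn.empty (by simpa using hA) x 0
    have := HasCircuitSize.phaseOp_wire (κ := κ) (Classical.arbitrary κ) fun _ : Fin d => f 0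
    rw [hc]
    exact this.mono (by simp)
  | insert t A ht ih =>
    let u (v : Fin d) (x : Dits d κ) : ℝ := f (Function.update x t v)
    have hu (v : Fin d) : DependsOn (u v) A := hA.comp_update_insert v
    -- Write `f` as the mean over the levels of `t` plus `(mean - u j) * levelSign j` summed over `j
    -- ≠ 0`. Level `j` gets `u j` directly; level `0` gets `u 0` because the deviations from the
    -- mean sum to zero.
    have hr : DependsOn (fun x => (∑ v, u v x) / d) A := fun x y hxy => by
      simp only [hu _ hxy]
    have hg (j : Fin d) : DependsOn (fun x => (∑ v, u v x) / d - u j x) A := fun x y hxy => by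
      simp only [hu _ hxy]
    have hsum := HasCircuitSize.phaseOp_sum (Finset.univ.erase (0 : Fin d)) _
      fun j hj => hasCircuitSize_phaseOp_levelSign t (Finset.ne_of_mem_erase hj) A ht _ (hg j)
    have htot := (ih _ hr).mul hsum
    rw [← phaseOp_add] at htot
    refine HasCircuitSize.mono
      (b := 3 * d ^ A.card + (Finset.univ.erase (0 : Fin d)).card * (3 * d ^ A.card - 2)) ?_ ?_
    · convert htot using 3 with x
      have hself : u (x t) x = f x := by simp [u]
      have hd : (d : ℝ) ≠ 0 := by exact_mod_cast NeZero.ne d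
      by_cases h0 : x t = 0
      · rw [h0] at hself
        have hcard : ((Finset.univ.erase (0 : Fin d)).card : ℝ) = d - 1 := by
          rw [Finset.card_erase_of_mem (Finset.mem_univ _), Finset.card_univ, Fintype.card_fin,
            Nat.cast_sub (NeZero.pos d), Nat.cast_one]
        have he : ∑ v ∈ Finset.univ.erase 0, u v x = ∑ v, u v x - f x := by
          rw [← hself, ← Finset.sum_erase_add _ _ (Finset.mem_univ (0 : Fin d))]
          ring
        simp only [levelSign, h0, if_true, mul_one, Finset.sum_sub_distrib, he,
          Finset.sum_const, nsmul_eq_mul, hcard]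
        field_simp
        ring
      · simp only [levelSign, h0, if_false, mul_ite, mul_neg, mul_one, mul_zero,
          Finset.sum_ite_eq, Finset.mem_erase, ne_eq, not_false_eq_true, Finset.mem_univ,
          and_self, if_true, hself]
        ring
    · rw [Finset.card_erase_of_mem (Finset.mem_univ _), Finset.card_univ, Fintype.card_fin,
        Finset.card_insert_of_notMem ht, pow_succ]
      calc _ ≤ 3 * d ^ A.card + (d - 1) * (3 * d ^ A.card) := by gcongr; omega
        _ = 3 * (d ^ A.card * d) := by
          rw [add_comm, sub_one_mul_add_self (NeZero.pos d)]
          ring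

end

/-! ### State synthesis -/

/-- The Hadamard matrix on the levels `0` and `j`, and the identity on the other levels. -/
def levelHadamard {d : ℕ} [NeZero d] (j : Fin d) : Matrix (Fin d) (Fin d) ℂ :=
  Matrix.of fun a b =>
    if a = 0 then (if b = 0 then (√2 : ℂ)⁻¹ else 0) + (if b = j then (√2 : ℂ)⁻¹ else 0)
    else if a = j then (if b = 0 then (√2 : ℂ)⁻¹ else 0) - (if b = j then (√2 : ℂ)⁻¹ else 0)
    else if b = a then 1 else 0

theorem levelHadamard_sum {d : ℕ} [NeZero d] (j a : Fin d) (v : Fin d → ℂ) :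
    ∑ b, levelHadamard j a b * v b =
      if a = 0 then (√2 : ℂ)⁻¹ * (v 0 + v j)
      else if a = j then (√2 : ℂ)⁻¹ * (v 0 - v j) else v a := by
  simp only [levelHadamard, Matrix.of_apply]
  split_ifs
  · simp [add_mul, Finset.sum_add_distrib, mul_add]
  · simp [sub_mul, Finset.sum_sub_distrib, mul_sub]
  · simp

theorem levelHadamard_mem_unitaryGroup {d : ℕ} [NeZero d] {j : Fin d} (hj : j ≠ 0) :
    levelHadamard j ∈ Matrix.unitaryGroup (Fin d) ℂ := by
  have hs : star (levelHadamard j) = levelHadamard j := by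
    ext a b
    simp only [Matrix.star_apply, levelHadamard, Matrix.of_apply]
    by_cases ha : a = 0 <;> by_cases hb : b = 0 <;> by_cases ha' : a = j <;> by_cases hb' : b = j <;>
      simp_all [eq_comm]
  have h2 : (√2 : ℂ)⁻¹ * (√2 : ℂ)⁻¹ = 1 / 2 := by
    rw [← mul_inv, ← Complex.ofReal_mul, Real.mul_self_sqrt zero_le_two]
    norm_num
  rw [Matrix.mem_unitaryGroup_iff, hs]
  ext a b
  rw [Matrix.mul_apply, levelHadamard_sum]
  simp only [levelHadamard, Matrix.of_apply, Matrix.one_apply]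
  have hj' := hj.symm
  by_cases ha : a = 0
  · subst ha
    by_cases hb : b = 0
    · subst hb
      simp [hj, hj', mul_add, h2]
      norm_num
    · by_cases hb' : b = j
      · subst hb'; simp [hj, hj']
      · simp [hb, hb', hj, Ne.symm hb]
  · by_cases ha' : a = j
    · subst ha'
      by_cases hb : b = 0
      · subst hb; simp [hj, hj']
      · by_cases hb' : b = a
        · subst hb'
          simp [hj, mul_add, h2]
          norm_num
        · simp [hb, hb', hj, Ne.symm hb']
    · simp [ha, ha', eq_comm]

/-- Choose `q` so that the rotated `b` is a quarter turn from `a`; sum and difference then have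
equal modulus. They are the two outputs of a Hadamard, so once their phases agree a second Hadamard
cancels level `j`. -/
theorem exists_phase_mul_add_eq_sub (a b : ℂ) : ∃ q r : ℝ,
    Complex.exp (r * Complex.I) * (a + Complex.exp (q * Complex.I) * b) =
      a - Complex.exp (q * Complex.I) * b := by
  have key : ∀ u w : ℂ, ‖u‖ = ‖w‖ → ∃ r : ℝ, Complex.exp (r * Complex.I) * u = w := by
    intro u w h
    refine ⟨w.arg - u.arg, ?_⟩
    calc _ = Complex.exp ((w.arg - u.arg : ℝ) * Complex.I) *
          (‖u‖ * Complex.exp (u.arg * Complex.I)) := by rw [Complex.norm_mul_exp_arg_mul_I]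
      _ = ‖w‖ * Complex.exp (w.arg * Complex.I) := by
        rw [h, mul_left_comm, ← Complex.exp_add]
        congr 2
        push_cast
        ring
      _ = w := Complex.norm_mul_exp_arg_mul_I w
  let q : ℝ := a.arg - b.arg + Real.pi / 2
  refine ⟨q, key _ _ ?_⟩
  have hb : Complex.exp (q * Complex.I) * b =
      Complex.exp (a.arg * Complex.I) * (‖b‖ * Complex.I) := by
    conv_lhs => rw [← Complex.norm_mul_exp_arg_mul_I b]
    rw [mul_left_comm, ← Complex.exp_add]
    have : (q : ℂ) * Complex.I + b.arg * Complex.I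
        = a.arg * Complex.I + Real.pi / 2 * Complex.I := by
      simp only [q]; push_cast; ring
    rw [this, Complex.exp_add, Complex.exp_pi_div_two_mul_I]
    ring
  have ha : a = Complex.exp (a.arg * Complex.I) * ‖a‖ := by
    rw [mul_comm, Complex.norm_mul_exp_arg_mul_I]
  have h1 : a + Complex.exp (q * Complex.I) * b
      = Complex.exp (a.arg * Complex.I) * (‖a‖ + ‖b‖ * Complex.I) := by
    rw [hb, mul_add, ← ha]
  have h2 : a - Complex.exp (q * Complex.I) * b
      = Complex.exp (a.arg * Complex.I) * (starRingEnd ℂ (‖a‖ + ‖b‖ * Complex.I)) := by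
    rw [hb]
    simp only [map_add, map_mul, Complex.conj_ofReal, Complex.conj_I, mul_add, ← ha]
    ring
  rw [h1, h2, norm_mul, norm_mul, Complex.norm_conj]

section
variable {d : ℕ} {κ : Type}

/-- The state `ψ` is a superposition of basis kets that are `0` on all wires outside `A`. -/
def SupportedOn [NeZero d] (A : Finset κ) (ψ : Dits d κ → ℂ) : Prop :=
  ∀ x, (∃ k ∉ A, x k ≠ 0) → ψ x = 0

variable [Fintype κ] [DecidableEq κ]

theorem exists_hasCircuitSize_levelHadamard [NeZero d] [Nontrivial κ] (t : κ) {j : Fin d}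
    (hj : j ≠ 0) : ∃ M : Matrix (Dits d κ) (Dits d κ) ℂ, HasCircuitSize M 1 ∧
      ∀ ψ x, M.mulVec ψ x =
        if x t = 0 then (√2 : ℂ)⁻¹ * (ψ (Function.update x t 0) + ψ (Function.update x t j))
        else if x t = j then
          (√2 : ℂ)⁻¹ * (ψ (Function.update x t 0) - ψ (Function.update x t j))
        else ψ x := by
  obtain ⟨q, hq⟩ := exists_ne t
  have hU : Matrix.kronecker (levelHadamard j) (1 : Matrix (Fin d) (Fin d) ℂ) ∈
      Matrix.unitaryGroup (Fin d × Fin d) ℂ :=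
    Matrix.kronecker_mem_unitary (levelHadamard_mem_unitaryGroup hj) (one_mem _)
  refine ⟨_, HasCircuitSize.of_wireOp hq.symm hU, fun ψ x => ?_⟩
  have hsum := levelHadamard_sum j (x t) fun b => ψ (Function.update x t b)
  simp only [Function.update_eq_self] at hsum
  rw [← hsum, Matrix.mulVec, dotProduct]
  rw [← Finset.sum_filter_of_ne (p := fun y : Dits d κ => ∀ k, k ≠ t → x k = y k)]
  · refine Finset.sum_nbij' (fun y => y t) (fun b => Function.update x t b) ?_ ?_ ?_ ?_ ?_
    · simp
    · intro b _
      simp only [Finset.mem_filter, Finset.mem_univ, true_and]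
      intro k hk
      simp [hk]
    · intro y hy
      simp only [Finset.mem_filter, Finset.mem_univ, true_and] at hy
      ext k
      by_cases hk : k = t
      · simp [hk]
      · simp [hk, hy k hk]
    · simp
    · intro y hy
      simp only [Finset.mem_filter, Finset.mem_univ, true_and] at hy
      have hy' : Function.update x t (y t) = y := by
        ext k
        by_cases hk : k = t
        · simp [hk]
        · simp [hk, hy k hk]
      rw [hy']
      simp only [wireOp, Matrix.of_apply, Matrix.kronecker, Matrix.kroneckerMap_apply]
      rw [if_pos fun k hk _ => hy k hk, hy q hq]
      simp
  · intro y _ hne k hk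
    by_contra hxy
    refine hne ?_
    simp only [wireOp, Matrix.of_apply, Matrix.kronecker, Matrix.kroneckerMap_apply]
    by_cases hkq : k = q
    · subst hkq
      simp [hxy]
    · rw [if_neg fun h => hxy (h k hk hkq), zero_mul]

/-- Rotate the amplitudes at level `j` of wire `t` into level `0`. -/
theorem exists_hasCircuitSize_clear_level [NeZero d] [Nontrivial κ] {t : κ} {j : Fin d}
    (hj : j ≠ 0) (A : Finset κ) (ht : t ∉ A) (ψ : Dits d κ → ℂ)
    (hψ : SupportedOn (insert t A) ψ) :
    ∃ M : Matrix (Dits d κ) (Dits d κ) ℂ, HasCircuitSize M (6 * d ^ (A.card + 1) + 2) ∧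
      SupportedOn (insert t A) (M.mulVec ψ) ∧ (∀ x, x t = j → M.mulVec ψ x = 0) ∧
      ∀ x, x t ≠ 0 → x t ≠ j → M.mulVec ψ x = ψ x := by
  choose qf rf hqr using exists_phase_mul_add_eq_sub
  obtain ⟨B, hB, hBv⟩ := exists_hasCircuitSize_levelHadamard (κ := κ) t hj
  -- Reading the amplitudes with the outside wires set to `0` makes the phases depend on `insert t
  -- A` only; on the support of `ψ` nothing changes.
  let mask (x : Dits d κ) : Dits d κ := fun k => if k ∈ A then x k else 0
  let a (x : Dits d κ) : ℂ := ψ (Function.update (mask x) t 0)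
  let b (x : Dits d κ) : ℂ := ψ (Function.update (mask x) t j)
  have hmask {x y : Dits d κ} (h : ∀ k ∈ A, x k = y k) : mask x = mask y := by
    ext k
    by_cases hk : k ∈ A <;> simp [mask, hk, h]
  let f₁ (x : Dits d κ) : ℝ := if x t = j then qf (a x) (b x) else 0
  let f₂ (x : Dits d κ) : ℝ := if x t = 0 then rf (a x) (b x) else 0
  have h₁ : DependsOn f₁ (insert t A : Finset κ) := fun x y h => by
    have hm : mask x = mask y := hmask fun k hk => h k (by simp [hk])
    have hxt : x t = y t := h t (by simp)
    simp only [f₁, a, b, hm, hxt]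
  have h₂ : DependsOn f₂ (insert t A : Finset κ) := fun x y h => by
    have hm : mask x = mask y := hmask fun k hk => h k (by simp [hk])
    have hxt : x t = y t := h t (by simp)
    simp only [f₂, a, b, hm, hxt]
  have hD₁ := hasCircuitSize_phaseOp _ f₁ h₁
  have hD₂ := hasCircuitSize_phaseOp _ f₂ h₂
  rw [Finset.card_insert_of_notMem ht] at hD₁ hD₂
  have hout {x : Dits d κ} (h : ∃ k ∉ insert t A, x k ≠ 0) (v : Fin d) :
      ∃ k ∉ insert t A, Function.update x t v k ≠ 0 := by
    obtain ⟨k, hk, hxk⟩ := h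
    have : k ≠ t := fun e => hk (e ▸ Finset.mem_insert_self t A)
    exact ⟨k, hk, by rwa [Function.update_of_ne this]⟩
  have hsuppB {φ : Dits d κ → ℂ} (hφ : SupportedOn (insert t A) φ) :
      SupportedOn (insert t A) (B.mulVec φ) := fun x hx => by
    rw [hBv, hφ x hx, hφ _ (hout hx 0), hφ _ (hout hx j)]
    simp
  have hsuppD (f : Dits d κ → ℝ) {φ : Dits d κ → ℂ} (hφ : SupportedOn (insert t A) φ) :
      SupportedOn (insert t A) ((phaseOp f).mulVec φ) := fun x hx => by
    rw [phaseOp, Matrix.mulVec_diagonal, hφ x hx, mul_zero]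
  refine ⟨B * phaseOp f₂ * (B * phaseOp f₁),
    ((hB.mul hD₂).mul (hB.mul hD₁)).mono (by omega), ?_⟩
  rw [← Matrix.mulVec_mulVec, ← Matrix.mulVec_mulVec, ← Matrix.mulVec_mulVec]
  have hsupp := hsuppB (hsuppD f₂ (hsuppB (hsuppD f₁ hψ)))
  refine ⟨hsupp, fun x hx => ?_, fun x hx0 hxj => ?_⟩
  · by_cases hxo : ∃ k ∉ insert t A, x k ≠ 0
    · exact hsupp x hxo
    · push Not at hxo
      have hup (v : Fin d) : Function.update (mask x) t v = Function.update x t v := by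
        ext k
        by_cases hk : k = t
        · subst hk; simp
        by_cases hkA : k ∈ A
        · simp [hk, mask, hkA]
        · simp [hk, mask, hkA, hxo k (by simp [hk, hkA])]
      have hmu (v : Fin d) : mask (Function.update x t v) = mask x :=
        hmask fun k hk => by
          rw [Function.update_of_ne]
          rintro rfl
          exact ht hk
      have := hqr (ψ (Function.update x t 0)) (ψ (Function.update x t j))
      simp only [hBv, phaseOp, Matrix.mulVec_diagonal, hx, hj, hj.symm, if_false, if_true,
        Function.update_self, Function.update_idem, f₁, f₂, a, b, hmu, hup, Complex.ofReal_zero,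
        zero_mul, Complex.exp_zero, one_mul]
      linear_combination (√2 : ℂ)⁻¹ * (√2 : ℂ)⁻¹ * this
  · simp only [hBv, phaseOp, Matrix.mulVec_diagonal, hx0, hxj, if_false, f₁, f₂,
      Complex.ofReal_zero, zero_mul, Complex.exp_zero, one_mul]

/-- Clearing level `j` alters only levels `0` and `j` of wire `t`, so levels cleared earlier stay
empty. -/
theorem exists_hasCircuitSize_clear_levels [NeZero d] [Nontrivial κ] {t : κ}
    (A : Finset κ) (ht : t ∉ A) (ψ : Dits d κ → ℂ) (hψ : SupportedOn (insert t A) ψ)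
    (S : Finset (Fin d)) (hS : 0 ∉ S) :
    ∃ M : Matrix (Dits d κ) (Dits d κ) ℂ,
      HasCircuitSize M (S.card * (6 * d ^ (A.card + 1) + 2)) ∧
      SupportedOn (insert t A) (M.mulVec ψ) ∧ ∀ x, x t ∈ S → M.mulVec ψ x = 0 := by
  induction S using Finset.induction_on with
  | empty => exact ⟨1, by simpa using HasCircuitSize.one, by simpa using hψ, by simp⟩
  | insert j S hj ih =>
    obtain ⟨M, hM, h1, h2⟩ := ih fun h => hS (Finset.mem_insert_of_mem h)
    have hj0 : j ≠ 0 := fun h => hS (h ▸ Finset.mem_insert_self j S)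
    obtain ⟨N, hN, h3, h4, h5⟩ := exists_hasCircuitSize_clear_level hj0 A ht _ h1
    refine ⟨N * M, (hN.mul hM).mono ?_, ?_⟩
    · rw [Finset.card_insert_of_notMem hj, add_mul, one_mul, add_comm]
    rw [← Matrix.mulVec_mulVec]
    refine ⟨h3, fun x hx => ?_⟩
    by_cases hxj : x t = j
    · exact h4 x hxj
    · have hxS : x t ∈ S := (Finset.mem_insert.1 hx).resolve_left hxj
      rw [h5 x (fun h => hS (h ▸ hx)) hxj, h2 x hxS]

theorem exists_hasCircuitSize_to_zero [NeZero d] [Nontrivial κ] (A : Finset κ)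
    (ψ : Dits d κ → ℂ) (hψ : SupportedOn A ψ) :
    ∃ M : Matrix (Dits d κ) (Dits d κ) ℂ, HasCircuitSize M (8 * d ^ (A.card + 1)) ∧
      ∃ r : ℝ, 0 ≤ r ∧ M.mulVec ψ = Pi.single 0 (r : ℂ) := by
  have hd : 0 < d := NeZero.pos d
  induction A using Finset.induction_on generalizing ψ with
  | empty =>
    refine ⟨phaseOp fun _ => -(ψ 0).arg,
      (hasCircuitSize_phaseOp ∅ _ (by simp [DependsOn])).mono ?_, ‖ψ 0‖, norm_nonneg _, ?_⟩
    · simp only [Finset.card_empty, pow_zero, zero_add, pow_one]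
      omega
    · ext x
      rw [phaseOp, Matrix.mulVec_diagonal]
      by_cases hx : x = 0
      · subst hx
        conv_lhs => rw [← Complex.norm_mul_exp_arg_mul_I (ψ 0)]
        rw [mul_left_comm, ← Complex.exp_add, Complex.norm_mul_exp_arg_mul_I]
        simp
      · obtain ⟨k, hk⟩ := Function.ne_iff.1 hx
        rw [hψ x ⟨k, by simp, hk⟩, Pi.single_eq_of_ne hx, mul_zero]
  | insert t A ht ih =>
    obtain ⟨M, hM, h1, h2⟩ := exists_hasCircuitSize_clear_levels A ht ψ hψ
      (Finset.univ.erase 0) (by simp)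
    have h3 : SupportedOn A (M.mulVec ψ) := by
      rintro x ⟨k, hk, hxk⟩
      by_cases hkt : k = t
      · subst hkt
        exact h2 x (by simpa using hxk)
      · exact h1 x ⟨k, by simp [hkt, hk], hxk⟩
    obtain ⟨N, hN, r, hr, hNr⟩ := ih _ h3
    refine ⟨N * M, (hN.mul hM).mono ?_, r, hr, by rw [← Matrix.mulVec_mulVec, hNr]⟩
    rw [Finset.card_erase_of_mem (Finset.mem_univ _), Finset.card_univ, Fintype.card_fin,
      Finset.card_insert_of_notMem ht]
    have hpos : 0 < d ^ (A.card + 1) := pow_pos hd _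
    -- The constant 8 is 6 from the two diagonals plus 2 from the Hadamards, as `2 ≤ 2 * d ^ (A.card
    -- + 1)`; the sum then telescopes.
    calc _ ≤ 8 * d ^ (A.card + 1) + (d - 1) * (8 * d ^ (A.card + 1)) := by gcongr; omega
      _ = 8 * d ^ (A.card + 1 + 1) := by
        rw [add_comm, sub_one_mul_add_self hd, pow_succ _ (A.card + 1)]
        ring

/-- Every unit vector is taken to `|0⟩` by a circuit of `O(d ^ n)` two-qudit gates. -/
theorem exists_hasCircuitSize_mulVec_eq_single [NeZero d] [Nontrivial κ] (ψ : Dits d κ → ℂ)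
    (hψ : star ψ ⬝ᵥ ψ = 1) :
    ∃ M : Matrix (Dits d κ) (Dits d κ) ℂ,
      HasCircuitSize M (8 * d ^ (Fintype.card κ + 1)) ∧ M.mulVec ψ = Pi.single 0 1 := by
  obtain ⟨M, hM, r, hr, hMr⟩ := exists_hasCircuitSize_to_zero Finset.univ ψ
    (by rintro x ⟨k, hk, _⟩; simp at hk)
  refine ⟨M, hM, ?_⟩
  have h : star (M.mulVec ψ) ⬝ᵥ M.mulVec ψ = 1 := by
    rw [Matrix.star_mulVec, Matrix.dotProduct_mulVec, Matrix.vecMul_vecMul,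
      ← Matrix.star_eq_conjTranspose, (Matrix.mem_unitaryGroup_iff').1 hM.mem_unitaryGroup,
      Matrix.vecMul_one, hψ]
  rw [hMr] at h ⊢
  have h' : (r : ℂ) * r = 1 := by simpa using h
  have h'' : r * r = 1 := by exact_mod_cast h'
  have : r = 1 := by nlinarith
  rw [this, Complex.ofReal_one]

end

/-! ### Synthesis of unitaries -/

section
variable {d : ℕ} {κ : Type} [Fintype κ] [DecidableEq κ]

theorem exists_arg_neg_conj_div {ζ : ℂ} (hζ : ζ ≠ 0) :
    ∃ θ : ℝ, Complex.exp (θ * Complex.I) * ζ = -starRingEnd ℂ ζ := by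
  refine ⟨(-starRingEnd ℂ ζ / ζ).arg, ?_⟩
  have h1 : ‖-starRingEnd ℂ ζ / ζ‖ = 1 := by
    rw [norm_div, norm_neg, Complex.norm_conj, div_self (norm_ne_zero_iff.2 hζ)]
  have h2 := Complex.norm_mul_exp_arg_mul_I (-starRingEnd ℂ ζ / ζ)
  rw [h1, Complex.ofReal_one, one_mul] at h2
  rw [h2, div_mul_cancel₀ _ hζ]

theorem HasCircuitSize.star_mulVec_dotProduct_mulVec {M : Matrix (Dits d κ) (Dits d κ) ℂ} {c : ℕ}
    (hM : HasCircuitSize M c) (u v : Dits d κ → ℂ) :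
    star (M.mulVec u) ⬝ᵥ M.mulVec v = star u ⬝ᵥ v := by
  rw [Matrix.star_mulVec, Matrix.dotProduct_mulVec, Matrix.vecMul_vecMul,
    ← Matrix.star_eq_conjTranspose, (Matrix.mem_unitaryGroup_iff').1 hM.mem_unitaryGroup,
    Matrix.vecMul_one]

/-- A complex reflection about a unit vector takes `O(d ^ n)` gates. -/
theorem exists_hasCircuitSize_reflection [NeZero d] [Nontrivial κ] (w : Dits d κ → ℂ)
    (hw : star w ⬝ᵥ w = 1) (θ : ℝ) :
    ∃ R : Matrix (Dits d κ) (Dits d κ) ℂ,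
      HasCircuitSize R (19 * d ^ (Fintype.card κ + 1)) ∧
      ∀ z, R.mulVec z = z + ((Complex.exp (θ * Complex.I) - 1) * (star w ⬝ᵥ z)) • w := by
  obtain ⟨L, hL, hLw⟩ := exists_hasCircuitSize_mulVec_eq_single w hw
  have hP := hasCircuitSize_phaseOp (κ := κ) Finset.univ
    (fun x : Dits d κ => if x = 0 then θ else 0) (fun x y h => by
      have : x = y := funext fun k => h k (by simp)
      rw [this])
  -- The count is 8 + 3 + 8 = 19.
  refine ⟨L.conjTranspose * phaseOp (fun x => if x = 0 then θ else 0) * L,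
    ((hL.conjTranspose.mul hP).mul hL).mono ?_, fun z => ?_⟩
  · have : d ^ Fintype.card κ ≤ d ^ (Fintype.card κ + 1) :=
      Nat.pow_le_pow_right (NeZero.pos d) (Nat.le_succ _)
    rw [Finset.card_univ]
    omega
  · have hLL : L.conjTranspose * L = 1 := (Matrix.mem_unitaryGroup_iff').1 hL.mem_unitaryGroup
    have h0 : L.mulVec z 0 = star w ⬝ᵥ z := by
      rw [← hL.star_mulVec_dotProduct_mulVec, hLw, ← Pi.single_star, star_one,
        single_one_dotProduct]
    have hPz : (phaseOp fun x : Dits d κ => if x = 0 then θ else 0).mulVec (L.mulVec z) =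
        L.mulVec z + ((Complex.exp (θ * Complex.I) - 1) * (star w ⬝ᵥ z)) • L.mulVec w := by
      ext x
      rw [phaseOp, Matrix.mulVec_diagonal, Pi.add_apply, Pi.smul_apply, hLw, ← h0]
      by_cases hx : x = 0
      · subst hx
        simp only [if_true, Pi.single_eq_same, smul_eq_mul, mul_one]
        ring
      · simp [hx]
    rw [← Matrix.mulVec_mulVec, ← Matrix.mulVec_mulVec, hPz, Matrix.mulVec_add,
      Matrix.mulVec_smul, Matrix.mulVec_mulVec, Matrix.mulVec_mulVec, hLL, Matrix.one_mulVec,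
      Matrix.one_mulVec]

/-- A Householder reflection along `u - v`. As `star u ⬝ᵥ v` need not be real, the eigenvalue `-1`
is replaced by a phase: sending `u` to `v` needs `(exp (θ * I) - 1) * ζ = -s`, which follows from
`exp (θ * I) * ζ = -conj ζ` and `ζ + conj ζ = s`. -/
theorem exists_hasCircuitSize_map_unit [NeZero d] [Nontrivial κ] (u v : Dits d κ → ℂ)
    (hu : star u ⬝ᵥ u = 1) (hv : star v ⬝ᵥ v = 1) :
    ∃ R : Matrix (Dits d κ) (Dits d κ) ℂ,
      HasCircuitSize R (19 * d ^ (Fintype.card κ + 1)) ∧ R.mulVec u = v ∧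
      ∀ z, star (u - v) ⬝ᵥ z = 0 → R.mulVec z = z := by
  by_cases huv : u = v
  · exact ⟨1, HasCircuitSize.one.mono (Nat.zero_le _), by simp [huv], by simp⟩
  have hδ : u - v ≠ 0 := sub_ne_zero.2 huv
  set s : ℝ := ∑ x, ‖(u - v) x‖ ^ 2 with hs
  have hsδ : star (u - v) ⬝ᵥ (u - v) = (s : ℂ) := by
    simp only [dotProduct, hs, Complex.ofReal_sum, Pi.star_apply, Complex.ofReal_pow]
    exact Finset.sum_congr rfl fun x _ => Complex.conj_mul' _
  have hspos : 0 < s := by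
    obtain ⟨x, hx⟩ := Function.ne_iff.1 hδ
    exact Finset.sum_pos' (fun _ _ => by positivity)
      ⟨x, Finset.mem_univ x, pow_pos (norm_pos_iff.2 hx) 2⟩
  set ζ : ℂ := star (u - v) ⬝ᵥ u with hζ
  have hconj : starRingEnd ℂ ζ = 1 - star u ⬝ᵥ v := by
    rw [hζ, star_sub, sub_dotProduct, hu, map_sub, map_one]
    congr 1
    rw [← Complex.star_def, Matrix.star_dotProduct, star_star, dotProduct_comm]
  have hsum : ζ + starRingEnd ℂ ζ = s := by
    rw [hconj, ← hsδ, dotProduct_sub, ← hζ, star_sub, sub_dotProduct, hv]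
    ring
  have hζ0 : ζ ≠ 0 := by
    intro h
    rw [h, map_zero, add_zero] at hsum
    exact hspos.ne (by exact_mod_cast hsum)
  obtain ⟨θ, hθ⟩ := exists_arg_neg_conj_div hζ0
  have hkk : ((√s)⁻¹ : ℂ) * (√s : ℂ)⁻¹ * s = 1 := by
    rw [← mul_inv, ← Complex.ofReal_mul, Real.mul_self_sqrt hspos.le]
    exact inv_mul_cancel₀ (by exact_mod_cast hspos.ne')
  have hstar : star (((√s)⁻¹ : ℂ) • (u - v)) = ((√s)⁻¹ : ℂ) • star (u - v) := by
    rw [star_smul]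
    congr 1
    simp
  have hw : star (((√s)⁻¹ : ℂ) • (u - v)) ⬝ᵥ (((√s)⁻¹ : ℂ) • (u - v)) = 1 := by
    rw [hstar, smul_dotProduct, dotProduct_smul, hsδ, smul_eq_mul, smul_eq_mul, ← mul_assoc, hkk]
  obtain ⟨R, hR, hRz⟩ := exists_hasCircuitSize_reflection _ hw θ
  refine ⟨R, hR, ?_, fun z hz => ?_⟩
  · rw [hRz, hstar, smul_dotProduct, ← hζ, smul_smul]
    have hcoef : (Complex.exp (θ * Complex.I) - 1) * (((√s)⁻¹ : ℂ) • ζ) * (√s : ℂ)⁻¹ = -1 := by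
      rw [smul_eq_mul]
      linear_combination ((√s)⁻¹ : ℂ) * (√s : ℂ)⁻¹ * hθ - ((√s)⁻¹ : ℂ) * (√s : ℂ)⁻¹ * hsum - hkk
    rw [hcoef]
    simp
  · rw [hRz, hstar, smul_dotProduct, hz]
    simp

/-- A unitary that fixes all basis kets outside `S` is a product of `|S|` reflections. -/
theorem hasCircuitSize_of_fixes [NeZero d] [Nontrivial κ] (S : Finset (Dits d κ))
    (U : Matrix (Dits d κ) (Dits d κ) ℂ) (hU : U ∈ Matrix.unitaryGroup (Dits d κ) ℂ)
    (hS : ∀ x ∉ S, U.mulVec (Pi.single x 1) = Pi.single x 1) :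
    HasCircuitSize U (S.card * (19 * d ^ (Fintype.card κ + 1))) := by
  induction S using Finset.induction_on generalizing U with
  | empty =>
    have : U = 1 := by
      ext x y
      have := congrFun (hS y (by simp)) x
      rw [Matrix.mulVec_single_one, Matrix.col_apply] at this
      rw [this, Matrix.one_apply, Pi.single_apply]
    rw [this]
    simpa using HasCircuitSize.one
  | insert p S hp ih =>
    have hUU : U.conjTranspose * U = 1 := (Matrix.mem_unitaryGroup_iff').1 hU
    have hinner (u v : Dits d κ → ℂ) : star (U.mulVec u) ⬝ᵥ U.mulVec v = star u ⬝ᵥ v := by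
      rw [Matrix.star_mulVec, Matrix.dotProduct_mulVec, Matrix.vecMul_vecMul, hUU,
        Matrix.vecMul_one]
    have hbasis (x y : Dits d κ) : star (Pi.single x (1 : ℂ)) ⬝ᵥ (Pi.single y (1 : ℂ)) =
        if x = y then 1 else 0 := by
      rw [← Pi.single_star, star_one, single_one_dotProduct, Pi.single_apply]
    obtain ⟨R, hR, hRu, hRz⟩ := exists_hasCircuitSize_map_unit (U.mulVec (Pi.single p 1))
      (Pi.single p 1) (by rw [hinner, hbasis, if_pos rfl]) (by rw [hbasis, if_pos rfl])
    have hRR : R.conjTranspose * R = 1 := (Matrix.mem_unitaryGroup_iff').1 hR.mem_unitaryGroup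
    have h := ih (R * U) (mul_mem hR.mem_unitaryGroup hU) fun x hx => by
      rw [← Matrix.mulVec_mulVec]
      by_cases hxp : x = p
      · rw [hxp, hRu]
      · have hUx := hS x (by simp [hx, hxp])
        rw [hUx]
        refine hRz _ ?_
        -- Since `U` fixes the ket `x`, the kets `p` and `U p` have the same inner product with it,
        -- so their difference is orthogonal to it and `R` fixes it too.
        have hpx := hinner (Pi.single p 1) (Pi.single x 1)
        rw [hUx] at hpx
        rw [star_sub, sub_dotProduct, hpx, sub_self]
    have htot := hR.conjTranspose.mul h
    rw [← mul_assoc, hRR, one_mul] at htot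
    refine htot.mono ?_
    rw [Finset.card_insert_of_notMem hp, add_mul, one_mul, add_comm]

theorem hasCircuitSize_of_mem_unitaryGroup [NeZero d] [Nontrivial κ]
    {U : Matrix (Dits d κ) (Dits d κ) ℂ} (hU : U ∈ Matrix.unitaryGroup (Dits d κ) ℂ) :
    HasCircuitSize U (d ^ Fintype.card κ * (19 * d ^ (Fintype.card κ + 1))) := by
  have := hasCircuitSize_of_fixes Finset.univ U hU (by simp)
  simpa using this

/-! ### Adding idle ancillas -/

variable {κ' : Type} [Fintype κ'] [DecidableEq κ']

theorem exists_circuit_sum (L : QuditCircuit d κ) :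
    ∃ L' : QuditCircuit d (κ ⊕ κ'), L'.length = L.length ∧
      ∀ (x y : Dits d κ) (z z' : Dits d κ'),
        L'.toMatrix (Sum.elim x z) (Sum.elim y z') = if z = z' then L.toMatrix x y else 0 := by
  induction L with
  | nil =>
    refine ⟨[], rfl, fun x y z z' => ?_⟩
    simp only [QuditCircuit.toMatrix, List.map_nil, List.prod_nil, Matrix.one_apply,
      Sum.elim_eq_iff]
    by_cases h : z = z' <;> simp [h]
  | cons g L ih =>
    obtain ⟨L', hlen, hL'⟩ := ih
    let g' : TwoQuditGate d (κ ⊕ κ') :=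
      ⟨Sum.inl g.fst, Sum.inl g.snd, fun h => g.fst_ne_snd (Sum.inl_injective h), g.op⟩
    have hg (x y : Dits d κ) (z z' : Dits d κ') :
        g'.toMatrix (Sum.elim x z) (Sum.elim y z') = if z = z' then g.toMatrix x y else 0 := by
      by_cases h : z = z'
      · subst h
        simp [g', TwoQuditGate.toMatrix]
      · obtain ⟨k, hk⟩ := Function.ne_iff.1 h
        simp only [TwoQuditGate.toMatrix, Matrix.of_apply, if_neg h]
        exact if_neg fun H => hk (H (Sum.inr k) (by simp [g']) (by simp [g']))
    refine ⟨g' :: L', by simp [hlen], fun x y z z' => ?_⟩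
    change (g'.toMatrix * L'.toMatrix) _ _ = if z = z' then
      (g.toMatrix * QuditCircuit.toMatrix L) x y else 0
    simp only [Matrix.mul_apply]
    rw [← (Equiv.sumArrowEquivProdArrow κ κ' (Fin d)).symm.sum_comp, Fintype.sum_prod_type]
    have he (c : Dits d κ × Dits d κ') :
        (Equiv.sumArrowEquivProdArrow κ κ' (Fin d)).symm c = Sum.elim c.1 c.2 := rfl
    simp only [he, hg, hL']
    by_cases h : z = z'
    · subst h
      simp
    · rw [if_neg h]
      refine Finset.sum_eq_zero fun u _ => Finset.sum_eq_zero fun v _ => ?_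
      by_cases hv : z = v
      · subst hv; simp [h]
      · simp [hv]

end

/-! ### The complexity bounds -/

section
variable {d n : ℕ} [NeZero d]

theorem stateComplexity_le (hn : 2 ≤ n) (a : ℕ) (ψ : EuclideanSpace ℂ (Dits d (Fin n)))
    (hψ : ‖ψ‖ = 1) : stateComplexity a ψ ≤ (8 * d ^ (n + 1) : ℕ) := by
  have : Nontrivial (Fin n) := Fin.nontrivial_iff_two_le.2 hn
  have h1 : star (ψ : Dits d (Fin n) → ℂ) ⬝ᵥ (ψ : Dits d (Fin n) → ℂ) = 1 := by
    have := inner_self_eq_norm_sq_to_K (𝕜 := ℂ) ψ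
    rw [EuclideanSpace.inner_eq_star_dotProduct, hψ, dotProduct_comm] at this
    simpa using this
  obtain ⟨M, hM, hMψ⟩ := exists_hasCircuitSize_mulVec_eq_single _ h1
  -- Preparing `ψ` is the inverse of taking `ψ` to `|0⟩`.
  obtain ⟨L, hL, hlen⟩ := hM.conjTranspose
  obtain ⟨L', hlen', hL'⟩ := exists_circuit_sum (κ' := Fin a) L
  have hprep : L'.Prepares ψ := by
    intro x z
    have h0 : (0 : Dits d (Fin n ⊕ Fin a)) =
        Sum.elim (0 : Dits d (Fin n)) (0 : Dits d (Fin a)) := by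
      ext k
      cases k <;> rfl
    have hcol : (ψ : Dits d (Fin n) → ℂ) = M.conjTranspose.mulVec (Pi.single 0 1) := by
      rw [← hMψ, Matrix.mulVec_mulVec, ← Matrix.star_eq_conjTranspose,
        (Matrix.mem_unitaryGroup_iff').1 hM.mem_unitaryGroup, Matrix.one_mulVec]
    rw [h0, hL', hL, hcol, Matrix.mulVec_single_one, Matrix.col_apply]
  refine (iInf₂_le L' hprep).trans ?_
  rw [hlen']
  simpa using (Nat.cast_le (α := ℕ∞)).2 hlen

theorem unitaryComplexity_le (hn : 2 ≤ n) (a : ℕ)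
    (U : Matrix.unitaryGroup (Dits d (Fin n)) ℂ) :
    unitaryComplexity a (U : Matrix (Dits d (Fin n)) (Dits d (Fin n)) ℂ) ≤
      (d ^ n * (19 * d ^ (n + 1)) : ℕ) := by
  have : Nontrivial (Fin n) := Fin.nontrivial_iff_two_le.2 hn
  obtain ⟨L, hL, hlen⟩ := hasCircuitSize_of_mem_unitaryGroup U.2
  obtain ⟨L', hlen', hL'⟩ := exists_circuit_sum (κ' := Fin a) L
  have himp : L'.Implements (U : Matrix (Dits d (Fin n)) (Dits d (Fin n)) ℂ) := by
    intro x y z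
    rw [hL', hL]
  refine (iInf₂_le L' himp).trans ?_
  rw [hlen']
  rw [Fintype.card_fin] at hlen
  exact Nat.cast_le.2 hlen

end

/-- Lengths are integers, so the real bound may be rounded up and compared inside `ℕ∞`; this also
covers an empty infimum, which is `⊤`. -/
theorem inv_mul_le_iInf {α : Type*} (P : α → Prop) (len : α → ℕ) {N D : ℕ} (hD : 0 < D)
    (h : ∀ L, P L → N ≤ len L * D) :
    (((D : ℝ≥0)⁻¹ : ℝ≥0) : ℝ≥0∞) * (N : ℝ≥0∞) ≤
      ((⨅ (L : α) (_ : P L), (len L : ℕ∞) : ℕ∞) : ℝ≥0∞) := by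
  have hD' : (0 : ℝ≥0) < D := by exact_mod_cast hD
  have hk : ((⌈(D : ℝ≥0)⁻¹ * N⌉₊ : ℕ) : ℕ∞) ≤ ⨅ (L : α) (_ : P L), (len L : ℕ∞) := by
    refine le_iInf₂ fun L hL => Nat.cast_le.2 (Nat.ceil_le.2 ?_)
    rw [inv_mul_le_iff₀ hD', mul_comm]
    exact_mod_cast h L hL
  calc (((D : ℝ≥0)⁻¹ : ℝ≥0) : ℝ≥0∞) * (N : ℝ≥0∞)
      ≤ ((⌈(D : ℝ≥0)⁻¹ * N⌉₊ : ℝ≥0) : ℝ≥0∞) := by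
        rw [← ENNReal.coe_natCast N, ← ENNReal.coe_mul, ENNReal.coe_le_coe]
        exact Nat.le_ceil _
    _ = (((⌈(D : ℝ≥0)⁻¹ * N⌉₊ : ℕ) : ℕ∞) : ℝ≥0∞) := by simp
    _ ≤ _ := ENat.toENNReal_le.2 hk

end

theorem mainTheorem1 (d : ℕ) [NeZero d] (hd : 2 ≤ d) :
    (∃ c C : ℝ≥0, 0 < c ∧ 0 < C ∧ ∀ n : ℕ, 2 ≤ n → ∀ a : ℕ,
      (∀ᵐ ψ : Metric.sphere (0 : EuclideanSpace ℂ (Dits d (Fin n))) 1 ∂(stateMeasure d n),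
        (c : ℝ≥0∞) * (d : ℝ≥0∞) ^ n ≤
          (stateComplexity a (ψ : EuclideanSpace ℂ (Dits d (Fin n))) : ℝ≥0∞)) ∧
      (∀ ψ : Metric.sphere (0 : EuclideanSpace ℂ (Dits d (Fin n))) 1,
        (stateComplexity a (ψ : EuclideanSpace ℂ (Dits d (Fin n))) : ℝ≥0∞) ≤
          (C : ℝ≥0∞) * (d : ℝ≥0∞) ^ n)) ∧
    (∃ c C : ℝ≥0, 0 < c ∧ 0 < C ∧ ∀ n : ℕ, 2 ≤ n → ∀ a : ℕ,
      (∀ᵐ U : Matrix.unitaryGroup (Dits d (Fin n)) ℂ ∂(unitaryMeasure d n),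
        (c : ℝ≥0∞) * (d : ℝ≥0∞) ^ (2 * n) ≤
          (unitaryComplexity a (U : Matrix (Dits d (Fin n)) (Dits d (Fin n)) ℂ) : ℝ≥0∞)) ∧
      (∀ U : Matrix.unitaryGroup (Dits d (Fin n)) ℂ,
        (unitaryComplexity a (U : Matrix (Dits d (Fin n)) (Dits d (Fin n)) ℂ) : ℝ≥0∞) ≤
          (C : ℝ≥0∞) * (d : ℝ≥0∞) ^ (2 * n))) := by
  have hd0 : 0 < d := by omega
  have hD : 0 < 2 * d ^ 4 := by positivity
  have hc : (0 : ℝ≥0) < ((2 * d ^ 4 : ℕ) : ℝ≥0)⁻¹ := inv_pos.2 (by exact_mod_cast hD)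
  -- The lower constant is one over the number of real parameters per gate; the upper ones absorb
  -- the extra factor `d` in `d ^ (n + 1)`.
  refine ⟨⟨((2 * d ^ 4 : ℕ) : ℝ≥0)⁻¹, ((8 * d : ℕ) : ℝ≥0), hc, ?_, fun n hn a => ⟨?_, ?_⟩⟩,
    ⟨((2 * d ^ 4 : ℕ) : ℝ≥0)⁻¹, ((19 * d : ℕ) : ℝ≥0), hc, ?_, fun n hn a => ⟨?_, ?_⟩⟩⟩
  · exact_mod_cast (by positivity : 0 < 8 * d)
  · filter_upwards [ae_le_stateComplexity d n a] with ψ hψ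
    have := inv_mul_le_iInf (fun L : QuditCircuit d (Fin n ⊕ Fin a) =>
      L.Prepares (ψ : EuclideanSpace ℂ (Dits d (Fin n)))) List.length (N := d ^ n) hD
      fun L hL => by
        have h1 := hψ L hL
        -- The radial parameter costs nothing: `2 * X ≤ 1 + Y` and `1 ≤ X` give `X ≤ Y`.
        have h2 : 0 < d ^ n := by positivity
        omega
    exact_mod_cast this
  · intro ψ
    have h := ENat.toENNReal_le.2 (stateComplexity_le hn a ψ.1 (by simp))
    refine h.trans (le_of_eq ?_)
    rw [ENat.toENNReal_coe, ENNReal.coe_natCast, ← Nat.cast_pow, ← Nat.cast_mul]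
    congr 1
    ring
  · exact_mod_cast (by positivity : 0 < 19 * d)
  · filter_upwards [ae_le_unitaryComplexity d n a] with U hU
    have := inv_mul_le_iInf (fun L : QuditCircuit d (Fin n ⊕ Fin a) =>
      L.Implements (U : Matrix (Dits d (Fin n)) (Dits d (Fin n)) ℂ)) List.length
      (N := d ^ (2 * n)) hD hU
    exact_mod_cast this
  · intro U
    have h := ENat.toENNReal_le.2 (unitaryComplexity_le hn a U)
    refine h.trans (le_of_eq ?_)
    rw [ENat.toENNReal_coe, ENNReal.coe_natCast, ← Nat.cast_pow, ← Nat.cast_mul]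
    congr 1
    ring
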